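/- **Conventions.** A *partial group* $\mathbf A=\langle A;*,e\rangle$ is a set with a partial binary operation $*$ and an element $e\in A$ such that $(a*b)*c=a*(b*c)$ whenever both sides are defined, and $e*a=a$, $a*e=a$ whenever the left side is defined. It is *square* if there is a subset $\sqrt A\subseteq A$ with $e\in\sqrt A$ such that $a*b$ is defined if and only if $a,b\in\sqrt A$, and every $c\in A$ equals $a*b$ for some $a,b\in\sqrt A$. It is *cancellative* if $x*y=x*z$ implies $y=z$ and $x*y=z*y$ implies $x=z$ (all products being defined). It *embeds* into a group $G$ if there is an injective map $\phi:A\to G$ with $\phi(a)\phi(b)=\phi(a*b)$ whenever $a*b$ is defined. **The Boolean monoid $\mathbf{M(A)}$.** Let $\mathbf A$ be a finite cancellative square partial group. Take the following distinct atoms, each going from a sort $i\in\{0,1,2\}$ to a sort $j\in\{0,1,2\}$: $e_i$ from $i$ to $i$ for $i=0,1,2$; $a_{01}$ from $0$ to $1$ and $a_{12}$ from $1$ to $2$ for each $a\in\sqrt A$; $a_{02}$ from $0$ to $2$ for each $a\in A$; and $w_{ij}$ from $i$ to $j$ for all $i,j\in\{0,1,2\}$. The atoms other than the $w_{ij}$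 are called *bijection atoms*; their products are $e_ip=p$ and $pe_j=p$ for $p$ from $i$ to $j$, and $a_{01}b_{12}=(a*b)_{02}$ for $a,b\in\sqrt A$. For an atom $x$ from $i$ to $j$ and an atom $y$ from $j'$ to $k$, the composition $x\cdot y$ is the empty set of atoms if $j\ne j'$. If $j=j'$, it is the following set of atoms from $i$ to $k$: just the product of $x$ and $y$ if both are bijection atoms; all except the products $xq$ with $q$ a bijection atom starting at $j$, if only $x$ is a bijection atom; all except the products $py$ with $p$ a bijection atom ending at $j$, if only $y$ is a bijection atom; and all of them if neither is. The elements of $\mathbf{M(A)}$ are all sets of atoms; $\wedge,\vee,-,0,\top$ are the operations of the power set Boolean algebra, $X\cdot Y=\bigcup_{x\in X,\,y\in Y}x\cdot y$, and the identity is $\mathsf e=\{e_0,e_1,e_2\}$. This is a Boolean monoid $\langle\cdot,\wedge,\vee,-,\mathsf e,0,\top\rangle$: a Boolean algebra with a monoid operation that distributes over $\vee$ and has $0$ as a zero. In a Boolean monoid put $D(a)=(a\top)\wedge\mathsf e$, $R(a)=(\top a)\wedge\mathsf e$ and $\div=-\mathsf e$. Call $a$ and $b$ domain equivalent if $D(a)=D(b)$,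 range equivalent if $R(a)=R(b)$, and write $a\in\mathtt i$ if $(a\div)\wedge a=0=(\div a)\wedge a$. Binary relations on a set $X$ are domain (range) equivalent if they have the same domain (range), and a binary relation is in $\mathtt i$ if it is an injective partial map. In (1)–(3), a *representation* on a base set $X$ is an injective map $h:M(A)\to\wp(X\times X)$ that takes $\cdot$ to relational composition and the other operations of the signature to their set-theoretic counterparts: $\wedge,\vee$ to $\cap,\cup$; $a\le b$ holds if and only if $h(a)\subseteq h(b)$; $h(-a)=h(\top)\setminus h(a)$; $h(0)=\emptyset$; $h(\mathsf e)=\{(x,x):x\in X\}$. An embedding as in (4) is an injective map $h:M(A)\to\wp(X\times X)$ that takes $\cdot$ to relational composition and preserves and reflects membership in $\mathtt i$, domain equivalence and range equivalence. **Theorem.** Let $\mathbf A$ be a finite cancellative square partial group. The following five statements are equivalent; and the five statements obtained by including all the words in square brackets are also equivalent. 1. $\mathbf{M(A)}$ has a representation in the signature $\langle\cdot,\wedge,\vee,-,\mathsf e,0,\top\rangle$ [over a finite base set]. 2. $\mathbf{M(A)}$ has a representation [over a finite base set] as a lattice-ordered semigroup, that is, in the signature $\langle\cdot,\wedge,\vee\rangle$,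 in which $h(\top)$ is an equivalence relation on the base set. 3. $\mathbf{M(A)}$ has a representation [over a finite base set] as an ordered complemented semigroup, that is, in the signature $\langle\cdot,\le,-\rangle$, in which $h(\top)$ is an equivalence relation on the base set. 4. There is an embedding of $\mathbf{M(A)}$ into $\wp(X\times X)$, for some [finite] set $X$, with respect to composition, $\mathtt i$, domain equivalence and range equivalence. 5. $\mathbf A$ embeds into a [finite] group. -/

import Mathlib

universe u

open scoped SetRel

/-- A partial group `⟨A; *, e⟩`: `mul a b = some c` means that `a * b` is defined and equals `c`.
The operation is associative, and `e` acts as an identity, whenever the products involved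
are defined. -/
structure PartialGroup (A : Type u) where
  mul : A → A → Option A
  e : A
  assoc : ∀ {a b c ab bc l r : A}, mul a b = some ab → mul b c = some bc →
    mul ab c = some l → mul a bc = some r → l = r
  e_mul : ∀ {a b : A}, mul e a = some b → b = a
  mul_e : ∀ {a b : A}, mul a e = some b → b = a

/-- The cancellation laws, for those products that are defined. -/
def PartialGroup.IsCancellative {A : Type u} (P : PartialGroup A) : Prop :=
  (∀ x y z w : A, P.mul x y = some w → P.mul x z = some w → y = z) ∧
  (∀ x y z w : A, P.mul x y = some w → P.mul z y = some w → x = z)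

/-- `P` embeds into the group `G`: some injective map respects all products defined in `P`. -/
def PartialGroup.EmbedsInto {A : Type u} (P : PartialGroup A) (G : Type u) [Group G] : Prop :=
  ∃ φ : A → G, Function.Injective φ ∧
    ∀ a b c : A, P.mul a b = some c → φ a * φ b = φ c

/-- A square partial group. The subset `sqrt` (written `√A`) is determined by the
multiplication, as the set of all `a` for which `a * a` is defined. -/
structure SquarePartialGroup (A : Type u) extends PartialGroup A where
  sqrt : Set A
  e_mem_sqrt : e ∈ sqrt
  mul_defined_iff : ∀ a b : A, (∃ c, mul a b = some c) ↔ (a ∈ sqrt ∧ b ∈ sqrt)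
  exists_mul_eq : ∀ c : A, ∃ a ∈ sqrt, ∃ b ∈ sqrt, mul a b = some c

/-- A Boolean monoid `⟨·, ∧, ∨, -, e, 0, ⊤⟩`: a Boolean algebra with a monoid structure whose
composition is normal (`0` is a zero) and additive. The identity `e` is `1`. -/
class BooleanMonoid (M : Type u) extends BooleanAlgebra M, Monoid M where
  mul_bot : ∀ a : M, a * ⊥ = ⊥
  bot_mul : ∀ a : M, ⊥ * a = ⊥
  mul_sup : ∀ a b c : M, a * (b ⊔ c) = a * b ⊔ a * c
  sup_mul : ∀ a b c : M, (a ⊔ b) * c = a * c ⊔ b * c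

namespace BooleanMonoid

variable {M : Type u} [BooleanMonoid M]

/-- `dom(a) = (a⊤) ∧ e`. -/
def dom (a : M) : M := (a * ⊤) ⊓ 1

/-- `ran(a) = (⊤a) ∧ e`. -/
def ran (a : M) : M := (⊤ * a) ⊓ 1

/-- The unary relation `i` in a Boolean monoid: `(a ÷) ∧ a = 0 = (÷ a) ∧ a`, where `÷ = -e`. -/
def IsInj (a : M) : Prop := (a * 1ᶜ) ⊓ a = ⊥ ∧ (1ᶜ * a) ⊓ a = ⊥

end BooleanMonoid

/-- The unary relation `i` for binary relations: `r r˘ ⊆ id` and `r˘ r ⊆ id`, that is, `r` is an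
injective partial map. -/
def SetRel.IsInj {X : Type u} (r : SetRel X X) : Prop :=
  r ○ r.inv ⊆ SetRel.id ∧ r.inv ○ r ⊆ SetRel.id

section Representations

variable {M : Type u} [BooleanMonoid M] {X : Type u}

/-- The binary relation `r` is an equivalence relation on its base set. -/
def SetRel.IsEquivalence (r : SetRel X X) : Prop :=
  Equivalence (fun x y : X => (x, y) ∈ r)

/-- A representation in the full signature `⟨·, ∧, ∨, -, e, 0, ⊤⟩`. Complements are taken
relative to the relation representing `⊤`. -/
structure IsBooleanMonoidRep (h : M → SetRel X X) : Prop where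
  injective : Function.Injective h
  map_mul : ∀ a b : M, h (a * b) = h a ○ h b
  map_inf : ∀ a b : M, h (a ⊓ b) = h a ∩ h b
  map_sup : ∀ a b : M, h (a ⊔ b) = h a ∪ h b
  map_compl : ∀ a : M, h aᶜ = h ⊤ \ h a
  map_one : h 1 = SetRel.id
  map_bot : h ⊥ = ∅

/-- A representation in the signature `⟨·, ∧, ∨⟩` of lattice-ordered semigroups. -/
structure IsLatticeOrderedSemigroupRep (h : M → SetRel X X) : Prop where
  injective : Function.Injective h
  map_mul : ∀ a b : M, h (a * b) = h a ○ h b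
  map_inf : ∀ a b : M, h (a ⊓ b) = h a ∩ h b
  map_sup : ∀ a b : M, h (a ⊔ b) = h a ∪ h b

/-- A representation in the signature `⟨·, ≤, -⟩` of ordered complemented semigroups. Complements
are taken relative to the union of all represented relations, which is `h ⊤`. -/
structure IsOrderedComplementedSemigroupRep (h : M → SetRel X X) : Prop where
  injective : Function.Injective h
  map_mul : ∀ a b : M, h (a * b) = h a ○ h b
  map_le_iff : ∀ a b : M, a ≤ b ↔ h a ⊆ h b
  map_compl : ∀ a : M, h aᶜ = h ⊤ \ h a

/-- An embedding into `℘(X × X)` in the signature with composition, the unary relation `i`,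
domain equivalence and range equivalence. -/
structure IsInjDomRanEmbedding (h : M → SetRel X X) : Prop where
  injective : Function.Injective h
  map_mul : ∀ a b : M, h (a * b) = h a ○ h b
  isInj_iff : ∀ a : M, BooleanMonoid.IsInj a ↔ (h a).IsInj
  dom_iff : ∀ a b : M,
    BooleanMonoid.dom a = BooleanMonoid.dom b ↔ (h a).dom = (h b).dom
  ran_iff : ∀ a b : M,
    BooleanMonoid.ran a = BooleanMonoid.ran b ↔ (h a).cod = (h b).cod

end Representations

namespace HirschJackson

variable {A : Type u}

/-- The atoms of `M(A)`. There are three sorts `0, 1, 2`, and every atom goes from one sort to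
another. `id i` is the part `e_i` of the identity at sort `i`; `a01 a`, `a12 a` (for `a ∈ √A`) and
`a02 a` (for `a ∈ A`) are the copies of `a` from sort `0` to `1`, from `1` to `2` and from `0`
to `2`; and `w i j` is what remains of the block of all pairs from sort `i` to sort `j`. -/
inductive Atom (S : SquarePartialGroup A) : Type u
  | id (i : Fin 3) : Atom S
  | a01 (a : A) (ha : a ∈ S.sqrt) : Atom S
  | a12 (a : A) (ha : a ∈ S.sqrt) : Atom S
  | a02 (a : A) : Atom S
  | w (i j : Fin 3) : Atom S

namespace Atom

variable {S : SquarePartialGroup A}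

/-- The sort at which an atom starts. -/
def src : Atom S → Fin 3
  | id i => i
  | a01 _ _ => 0
  | a12 _ _ => 1
  | a02 _ => 0
  | w i _ => i

/-- The sort at which an atom ends. -/
def tgt : Atom S → Fin 3
  | id i => i
  | a01 _ _ => 1
  | a12 _ _ => 2
  | a02 _ => 2
  | w _ j => j

/-- The atoms other than the `w i j`: they are meant to be bijections between the sorts. -/
def IsBij : Atom S → Prop
  | w _ _ => False
  | _ => True

/-- `BijMul p q r`: the composition of the bijection atoms `p` and `q` is the bijection
atom `r`. -/
def BijMul (p q r : Atom S) : Prop :=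
  p.IsBij ∧ q.IsBij ∧
  ((p = id q.src ∧ r = q) ∨ (q = id p.tgt ∧ r = p) ∨
    ∃ (a b c : A) (ha : a ∈ S.sqrt) (hb : b ∈ S.sqrt),
      S.mul a b = some c ∧ p = a01 a ha ∧ q = a12 b hb ∧ r = a02 c)

/-- `Comp x y z`: the atom `z` lies below the composition `x · y` of the atoms `x` and `y`.
If `x` ends where `y` starts, then, within the block of all atoms from the start of `x` to the end
of `y`, the composition is
* the product of `x` and `y` if both are bijection atoms;
* everything except the products of `x` with bijection atoms, if only `x` is a bijection atom;
* everything except the products of bijection atoms with `y`, if only `y` is a bijection atom;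
* everything, if neither is a bijection atom.

If `x` does not end where `y` starts, then the composition is `0`. -/
def Comp (x y z : Atom S) : Prop :=
  x.tgt = y.src ∧ z.src = x.src ∧ z.tgt = y.tgt ∧
  (x.IsBij → y.IsBij → BijMul x y z) ∧
  (x.IsBij → ¬ y.IsBij → ∀ q, ¬ BijMul x q z) ∧
  (¬ x.IsBij → y.IsBij → ∀ p, ¬ BijMul p y z)

/-- The composition of two sets of atoms: all atoms below a composition of their members. -/
def compSet (X Y : Set (Atom S)) : Set (Atom S) := {z | ∃ x ∈ X, ∃ y ∈ Y, Comp x y z}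

/-- The set of the three identity atoms. -/
def idSet (S : SquarePartialGroup A) : Set (Atom S) := Set.range id

theorem BijMul.data {p q r : Atom S} (h : BijMul p q r) :
    p.IsBij ∧ q.IsBij ∧ r.IsBij ∧ p.tgt = q.src ∧ r.src = p.src ∧ r.tgt = q.tgt := by
  cases p <;> cases q <;> cases r <;> simp_all [BijMul, IsBij, src, tgt] <;> grind

theorem BijMul.unique {p q r s : Atom S} (h : BijMul p q r) (h' : BijMul p q s) : r = s := by
  cases p <;> cases q <;> simp_all [BijMul, IsBij, src, tgt] <;> grind

theorem BijMul.cancel_left (hS : S.IsCancellative) {p q q' r : Atom S}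
    (h : BijMul p q r) (h' : BijMul p q' r) : q = q' := by
  have := hS.1
  cases p <;> cases q <;> cases q' <;>
    simp [BijMul, IsBij, src, tgt] at h h' <;> grind

theorem BijMul.cancel_right (hS : S.IsCancellative) {p p' q r : Atom S}
    (h : BijMul p q r) (h' : BijMul p' q r) : p = p' := by
  have := hS.2
  cases p <;> cases q <;> cases p' <;>
    simp [BijMul, IsBij, src, tgt] at h h' <;> grind

theorem exists_bijMul {p q : Atom S} (hp : p.IsBij) (hq : q.IsBij) (h : p.tgt = q.src) :
    ∃ r, BijMul p q r := by
  have key (a b : A) (ha : a ∈ S.sqrt) (hb : b ∈ S.sqrt) : ∃ c, S.mul a b = some c :=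
    (S.mul_defined_iff a b).2 ⟨ha, hb⟩
  cases p <;> cases q <;> simp_all [BijMul, src, tgt, IsBij]

theorem BijMul.assoc {x y z xy yz : Atom S} (h1 : BijMul x y xy) (h2 : BijMul y z yz)
    (t : Atom S) : BijMul xy z t ↔ BijMul x yz t := by
  cases x <;> cases y <;> cases z <;> simp_all [BijMul, src, tgt, IsBij] <;> grind

theorem BijMul.split_right {x y q xy t : Atom S} (h : BijMul x y xy) (k : BijMul xy q t) :
    ∃ v, BijMul y q v ∧ BijMul x v t := by
  obtain ⟨v, hv⟩ := exists_bijMul (p := y) (q := q) h.data.2.1 k.data.2.1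
    (h.data.2.2.2.2.2.symm.trans k.data.2.2.2.1)
  exact ⟨v, hv, (BijMul.assoc h hv t).1 k⟩

theorem BijMul.split_left {p y z yz t : Atom S} (h : BijMul y z yz) (k : BijMul p yz t) :
    ∃ v, BijMul p y v ∧ BijMul v z t := by
  obtain ⟨v, hv⟩ := exists_bijMul (p := p) (q := y) k.data.1 h.data.1
    (k.data.2.2.2.1.trans h.data.2.2.2.2.1)
  exact ⟨v, hv, (BijMul.assoc hv h t).2 k⟩

theorem not_isBij_w (i j : Fin 3) : ¬ (w i j : Atom S).IsBij := fun h => h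

theorem comp_bb {x y z : Atom S} (hx : x.IsBij) (hy : y.IsBij) : Comp x y z ↔ BijMul x y z := by
  have := fun h : BijMul x y z => h.data
  simp only [Comp]
  tauto

theorem comp_bw {x y z : Atom S} (hx : x.IsBij) (hy : ¬ y.IsBij) : Comp x y z ↔
    x.tgt = y.src ∧ z.src = x.src ∧ z.tgt = y.tgt ∧ ∀ q, ¬ BijMul x q z := by
  simp only [Comp]
  tauto

theorem comp_wb {x y z : Atom S} (hx : ¬ x.IsBij) (hy : y.IsBij) : Comp x y z ↔
    x.tgt = y.src ∧ z.src = x.src ∧ z.tgt = y.tgt ∧ ∀ p, ¬ BijMul p y z := by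
  simp only [Comp]
  tauto

theorem comp_ww {x y z : Atom S} (hx : ¬ x.IsBij) (hy : ¬ y.IsBij) : Comp x y z ↔
    x.tgt = y.src ∧ z.src = x.src ∧ z.tgt = y.tgt := by
  simp only [Comp]
  tauto

theorem comp_assoc (hS : S.IsCancellative) (x y z t : Atom S) :
    (∃ u, Comp x y u ∧ Comp u z t) ↔ (∃ v, Comp y z v ∧ Comp x v t) := by
  have nb : ∀ {p q : Atom S} {i j}, ¬ BijMul p q (w i j) := fun h => h.data.2.2.1
  have nw := not_isBij_w (S := S)
  -- Both sides imply composability and that `t` lies in the right block.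
  suffices H : x.tgt = y.src → y.tgt = z.src → t.src = x.src → t.tgt = z.tgt →
      ((∃ u, Comp x y u ∧ Comp u z t) ↔ (∃ v, Comp y z v ∧ Comp x v t)) by
    constructor
    · intro h
      have ⟨u, h1, h2⟩ := h
      exact (H h1.1 (h1.2.2.1.symm.trans h2.1) (h2.2.1.trans h1.2.1) h2.2.2.1).1 h
    · intro h
      have ⟨u, h1, h2⟩ := h
      exact (H (h2.1.trans h1.2.1) h1.1 h2.2.1 (h2.2.2.1.trans h1.2.2.1)).2 h
  intro e1 e2 e3 e4
  by_cases hx : x.IsBij <;> by_cases hy : y.IsBij <;> by_cases hz : z.IsBij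
  · obtain ⟨u, hu⟩ := exists_bijMul hx hy e1
    obtain ⟨v, hv⟩ := exists_bijMul hy hz e2
    trans BijMul u z t
    · refine ⟨fun ⟨u', h, k⟩ => ?_, fun h => ⟨u, (comp_bb hx hy).2 hu,
        (comp_bb hu.data.2.2.1 hz).2 h⟩⟩
      obtain rfl := hu.unique ((comp_bb hx hy).1 h)
      exact (comp_bb hu.data.2.2.1 hz).1 k
    · rw [BijMul.assoc hu hv]
      refine ⟨fun h => ⟨v, (comp_bb hy hz).2 hv, (comp_bb hx hv.data.2.2.1).2 h⟩,
        fun ⟨v', h, k⟩ => ?_⟩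
      obtain rfl := hv.unique ((comp_bb hy hz).1 h)
      exact (comp_bb hx hv.data.2.2.1).1 k
  · obtain ⟨u, hu⟩ := exists_bijMul hx hy e1
    have du := hu.data
    trans ∀ q, ¬ BijMul u q t
    · refine ⟨fun ⟨u', h, k⟩ => ?_, fun h => ⟨u, (comp_bb hx hy).2 hu,
        (comp_bw hu.data.2.2.1 hz).2 ⟨by grind, by grind, e4, h⟩⟩⟩
      obtain rfl := hu.unique ((comp_bb hx hy).1 h)
      exact ((comp_bw hu.data.2.2.1 hz).1 k).2.2.2
    · constructor
      · intro h
        by_cases hq : ∃ q, BijMul x q t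
        · obtain ⟨q, hq⟩ := hq
          have dq := hq.data
          exact ⟨q, (comp_bw hy hz).2 ⟨e2, by grind, by grind, fun q' hq' =>
            h q' ((BijMul.assoc hu hq' t).2 hq)⟩, (comp_bb hx dq.2.1).2 hq⟩
        · exact ⟨w y.src z.tgt, (comp_bw hy hz).2 ⟨e2, rfl, rfl, fun _ => nb⟩,
            (comp_bw hx (nw _ _)).2 ⟨e1, e3, e4, fun q k => hq ⟨q, k⟩⟩⟩
      · rintro ⟨v, h, k⟩ q hq
        obtain ⟨v', h1, h2⟩ := hu.split_right hq
        by_cases hv : v.IsBij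
        · obtain rfl := ((comp_bb hx hv).1 k).cancel_left hS h2
          exact ((comp_bw hy hz).1 h).2.2.2 q h1
        · exact ((comp_bw hx hv).1 k).2.2.2 _ h2
  · trans ∀ q s, BijMul x q s → ¬ BijMul s z t
    · constructor
      · rintro ⟨u, h, k⟩ q s hs ht
        by_cases hu : u.IsBij
        · obtain rfl := ((comp_bb hu hz).1 k).cancel_right hS ht
          exact ((comp_bw hx hy).1 h).2.2.2 q hs
        · exact ((comp_wb hu hz).1 k).2.2.2 _ ht
      · intro h
        by_cases hq : ∃ q, BijMul q z t
        · obtain ⟨q, hq⟩ := hq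
          have dq := hq.data
          exact ⟨q, (comp_bw hx hy).2 ⟨e1, by grind, by grind, fun q' hq' =>
            h q' _ hq' hq⟩, (comp_bb dq.1 hz).2 hq⟩
        · exact ⟨w x.src y.tgt, (comp_bw hx hy).2 ⟨e1, rfl, rfl, fun _ => nb⟩,
            (comp_wb (nw _ _) hz).2 ⟨e2, e3, e4, fun q k => hq ⟨q, k⟩⟩⟩
    · constructor
      · intro h
        by_cases hq : ∃ q, BijMul x q t
        · obtain ⟨q, hq⟩ := hq
          have dq := hq.data
          refine ⟨q, (comp_wb hy hz).2 ⟨e2, by grind, by grind, fun q' hq' => ?_⟩,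
            (comp_bb hx dq.2.1).2 hq⟩
          obtain ⟨v, hv, hv'⟩ := hq'.split_left hq
          exact h _ _ hv hv'
        · exact ⟨w y.src z.tgt, (comp_wb hy hz).2 ⟨e2, rfl, rfl, fun _ => nb⟩,
            (comp_bw hx (nw _ _)).2 ⟨e1, e3, e4, fun q k => hq ⟨q, k⟩⟩⟩
      · rintro ⟨v, h, k⟩ q s hs ht
        obtain ⟨v', h1, h2⟩ := hs.split_right ht
        by_cases hv : v.IsBij
        · obtain rfl := ((comp_bb hx hv).1 k).cancel_left hS h2
          exact ((comp_wb hy hz).1 h).2.2.2 q h1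
        · exact ((comp_bw hx hv).1 k).2.2.2 _ h2
  · refine iff_of_true ⟨w x.src y.tgt, (comp_bw hx hy).2 ⟨e1, rfl, rfl, fun _ => nb⟩,
      (comp_ww (nw _ _) hz).2 ⟨e2, e3, e4⟩⟩ ?_
    by_cases hq : ∃ q, BijMul x q t
    · obtain ⟨q, hq⟩ := hq
      have dq := hq.data
      exact ⟨q, (comp_ww hy hz).2 ⟨e2, by grind, by grind⟩, (comp_bb hx dq.2.1).2 hq⟩
    · exact ⟨w y.src z.tgt, (comp_ww hy hz).2 ⟨e2, rfl, rfl⟩,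
        (comp_bw hx (nw _ _)).2 ⟨e1, e3, e4, fun q k => hq ⟨q, k⟩⟩⟩
  · obtain ⟨v, hv⟩ := exists_bijMul hy hz e2
    have dv := hv.data
    trans ∀ p, ¬ BijMul p v t
    · constructor
      · rintro ⟨u, h, k⟩ p hp
        obtain ⟨u', h1, h2⟩ := hv.split_left hp
        by_cases hu : u.IsBij
        · obtain rfl := ((comp_bb hu hz).1 k).cancel_right hS h2
          exact ((comp_wb hx hy).1 h).2.2.2 p h1
        · exact ((comp_wb hu hz).1 k).2.2.2 _ h2
      · intro h
        by_cases hq : ∃ q, BijMul q z t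
        · obtain ⟨q, hq⟩ := hq
          have dq := hq.data
          exact ⟨q, (comp_wb hx hy).2 ⟨e1, by grind, by grind, fun p hp =>
            h p ((BijMul.assoc hp hv t).1 hq)⟩, (comp_bb dq.1 hz).2 hq⟩
        · exact ⟨w x.src y.tgt, (comp_wb hx hy).2 ⟨e1, rfl, rfl, fun _ => nb⟩,
            (comp_wb (nw _ _) hz).2 ⟨e2, e3, e4, fun q k => hq ⟨q, k⟩⟩⟩
    · refine ⟨fun h => ⟨v, (comp_bb hy hz).2 hv,
        (comp_wb hx hv.data.2.2.1).2 ⟨by grind, e3, by grind, h⟩⟩, fun ⟨v', h, k⟩ => ?_⟩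
      obtain rfl := hv.unique ((comp_bb hy hz).1 h)
      exact ((comp_wb hx hv.data.2.2.1).1 k).2.2.2
  · exact iff_of_true ⟨w x.src y.tgt, (comp_wb hx hy).2 ⟨e1, rfl, rfl, fun _ => nb⟩,
      (comp_ww (nw _ _) hz).2 ⟨e2, e3, e4⟩⟩ ⟨w y.src z.tgt, (comp_bw hy hz).2
      ⟨e2, rfl, rfl, fun _ => nb⟩, (comp_ww hx (nw _ _)).2 ⟨e1, e3, e4⟩⟩
  · refine iff_of_true ?_ ⟨w y.src z.tgt, (comp_wb hy hz).2 ⟨e2, rfl, rfl, fun _ => nb⟩,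
      (comp_ww hx (nw _ _)).2 ⟨e1, e3, e4⟩⟩
    by_cases hq : ∃ q, BijMul q z t
    · obtain ⟨q, hq⟩ := hq
      have dq := hq.data
      exact ⟨q, (comp_ww hx hy).2 ⟨e1, by grind, by grind⟩, (comp_bb dq.1 hz).2 hq⟩
    · exact ⟨w x.src y.tgt, (comp_ww hx hy).2 ⟨e1, rfl, rfl⟩,
        (comp_wb (nw _ _) hz).2 ⟨e2, e3, e4, fun q k => hq ⟨q, k⟩⟩⟩
  · exact iff_of_true ⟨w x.src y.tgt, (comp_ww hx hy).2 ⟨e1, rfl, rfl⟩,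
      (comp_ww (nw _ _) hz).2 ⟨e2, e3, e4⟩⟩ ⟨w y.src z.tgt, (comp_ww hy hz).2
      ⟨e2, rfl, rfl⟩, (comp_ww hx (nw _ _)).2 ⟨e1, e3, e4⟩⟩

theorem compSet_assoc (hS : S.IsCancellative) (X Y Z : Set (Atom S)) :
    compSet (compSet X Y) Z = compSet X (compSet Y Z) := by
  have key := comp_assoc hS
  ext t
  constructor
  · rintro ⟨u, ⟨x, hx, y, hy, hu⟩, z, hz, ht⟩
    obtain ⟨v, hv, hv'⟩ := (key x y z t).1 ⟨u, hu, ht⟩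
    exact ⟨x, hx, v, ⟨y, hy, z, hz, hv⟩, hv'⟩
  · rintro ⟨x, hx, v, ⟨y, hy, z, hz, hv⟩, ht⟩
    obtain ⟨u, hu, hu'⟩ := (key x y z t).2 ⟨v, hv, ht⟩
    exact ⟨u, ⟨x, hx, y, hy, hu⟩, z, hz, hu'⟩

theorem comp_id_iff (i : Fin 3) (x z : Atom S) :
    Comp x (id i) z ↔ i = x.tgt ∧ z = x := by
  have key (p q : Atom S) (i : Fin 3) : BijMul p (id i) q ↔ p.IsBij ∧ i = p.tgt ∧ q = p := by
    cases p <;> cases q <;> simp [BijMul, src, tgt, IsBij] <;> grind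
  by_cases hx : x.IsBij
  · simp only [Comp, key]
    simp [IsBij, src]
    grind [tgt]
  · cases x <;> simp [IsBij] at hx
    simp only [Comp, key]
    cases z <;> simp [IsBij, src, tgt] <;> grind

theorem id_comp_iff (i : Fin 3) (x z : Atom S) :
    Comp (id i) x z ↔ i = x.src ∧ z = x := by
  have key (p q : Atom S) (i : Fin 3) : BijMul (id i) p q ↔ p.IsBij ∧ i = p.src ∧ q = p := by
    cases p <;> cases q <;> simp [BijMul, src, tgt, IsBij] <;> grind
  by_cases hx : x.IsBij
  · simp only [Comp, key]
    simp [IsBij, src]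
    grind [tgt]
  · cases x <;> simp [IsBij] at hx
    simp only [Comp, key]
    cases z <;> simp [IsBij, src, tgt] <;> grind

end Atom

/-- The Boolean monoid `M(A)`: its elements are all sets of atoms, with the Boolean operations of
the power set, composition determined by the composition of atoms, and identity
`{e_0, e_1, e_2}`. -/
def BM (S : SquarePartialGroup A) (_hS : S.IsCancellative) : Type u := Set (Atom S)

variable {S : SquarePartialGroup A} {hS : S.IsCancellative}

instance : BooleanAlgebra (BM S hS) := inferInstanceAs (BooleanAlgebra (Set (Atom S)))

instance : BooleanMonoid (BM S hS) where
  mul X Y := Atom.compSet X Y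
  one := Atom.idSet S
  mul_assoc := Atom.compSet_assoc hS
  one_mul X := by
    change Atom.compSet (Atom.idSet S) X = X
    ext z
    simp [Atom.compSet, Atom.idSet, Atom.id_comp_iff]
  mul_one X := by
    change Atom.compSet X (Atom.idSet S) = X
    ext z
    simp [Atom.compSet, Atom.idSet, Atom.comp_id_iff]
  mul_bot X := by
    change Atom.compSet X ∅ = ∅
    ext z
    simp [Atom.compSet]
  bot_mul X := by
    change Atom.compSet ∅ X = ∅
    ext z
    simp [Atom.compSet]
  mul_sup X Y Z := by
    change Atom.compSet X (Y ∪ Z) = Atom.compSet X Y ∪ Atom.compSet X Z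
    ext z
    simp [Atom.compSet]
    grind
  sup_mul X Y Z := by
    change Atom.compSet (X ∪ Y) Z = Atom.compSet X Z ∪ Atom.compSet Y Z
    ext z
    simp [Atom.compSet]
    grind

end HirschJackson

/-! Every condition is compared with the group embedding. In each of the first four, the bijection
atoms can be turned into actual bijections between three sets `Y 0`, `Y 1`, `Y 2`. If `γ a : Y 0 → Y
2` is the bijection given by `a02 a`, then following `γ a` and going back along `γ e` gives a
permutation of `Y 0`. The relations `a01 a · a12 b = a02 (a * b)` make this assignment respect
products (`exists_embedsInto_perm`).

An embedding in the fourth sense supplies such bijections at once, because its signature says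
exactly that the atoms are injective partial maps with matching domains and ranges. The other three
kinds of representation are first cut down to an `IsPartialRep`, where `h ⊤` is a partial
equivalence relation. There `h 1` is a congruence, and bijection atoms become injective partial maps
on its classes.

Conversely, let `φ` embed `A` into `G`. Take three copies of `G` as base set and label the pair
`((i, g), (j, k))` by the bijection atom `p` from `i` to `j` with `g φ(p) = k`, or by `w i j` if
there is none. For this to be a representation, products involving `w` need enough witnesses, so `G`
is first replaced by `G × ℤ/3`. The resulting representation has the full relation as top, hence
serves all four conditions. Both directions preserve finiteness. -/

/-! ### Injective partial maps -/

theorem SetRel.isInj_iff {X : Type u} {r : SetRel X X} : r.IsInj ↔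
    (∀ x x' y, (x, y) ∈ r → (x', y) ∈ r → x = x') ∧
      (∀ x y y', (x, y) ∈ r → (x, y') ∈ r → y = y') := by
  constructor
  · exact fun h => ⟨fun x x' y h1 h2 => h.1 (show (x, x') ∈ r ○ r.inv from ⟨y, h1, h2⟩),
      fun x y y' h1 h2 => h.2 (show (y, y') ∈ r.inv ○ r from ⟨x, h1, h2⟩)⟩
  · refine fun h => ⟨?_, ?_⟩
    · rintro ⟨x, x'⟩ ⟨y, h1, h2⟩
      exact h.1 x x' y h1 h2
    · rintro ⟨y, y'⟩ ⟨x, h1, h2⟩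
      exact h.2 x y y' h1 h2

theorem SetRel.IsInj.exists_equiv {X : Type u} {r : SetRel X X} (h : r.IsInj) {Y Z : Set X}
    (hY : r.dom = Y) (hZ : r.cod = Z) :
    ∃ f : Y ≃ Z, ∀ y z, (y, z) ∈ r ↔ ∃ hy : y ∈ Y, (f ⟨y, hy⟩ : X) = z := by
  subst hY hZ
  rw [SetRel.isInj_iff] at h
  have hex (y : r.dom) : ∃ z, ((y : X), z) ∈ r := y.2
  choose g hg using hex
  refine ⟨Equiv.ofBijective (fun y => ⟨g y, y, hg y⟩) ⟨fun y y' hyy => ?_, ?_⟩, fun y z => ?_⟩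
  · have hyy : g y = g y' := congrArg Subtype.val hyy
    exact Subtype.ext (h.1 _ _ _ (hg y) (hyy ▸ hg y'))
  · rintro ⟨z, y, hy⟩
    exact ⟨⟨y, z, hy⟩, Subtype.ext (h.2 _ _ _ (hg _) hy)⟩
  · constructor
    · exact fun hy => ⟨⟨z, hy⟩, h.2 _ _ _ (hg _) hy⟩
    · rintro ⟨hy, rfl⟩
      exact hg ⟨y, hy⟩

/-- Factor `(x, y)` through some `z`. Functionality forces `z = y`, so `x` and `y` are both sent to
`y`. This makes the identity atoms act as partial identities. -/
theorem SetRel.IsInj.eq_of_idempotent {X : Type u} {r : SetRel X X} (h : r.IsInj)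
    (hr : r ○ r = r) {x y : X} (hxy : (x, y) ∈ r) : x = y := by
  rw [SetRel.isInj_iff] at h
  have h' := hxy
  rw [← hr] at h'
  obtain ⟨z, h1, h2⟩ := h'
  obtain rfl := h.2 _ _ _ h1 hxy
  exact h.1 _ _ _ hxy h2

/-! ### From bijections between three sorts to a group embedding -/

namespace HirschJackson

open Atom

variable {A : Type u} {S : SquarePartialGroup A}

theorem Atom.bijMul_id_id (i : Fin 3) : BijMul (id i : Atom S) (id i) (id i) :=
  ⟨trivial, trivial, Or.inl ⟨rfl, rfl⟩⟩

theorem Atom.bijMul_of_mul {a b c : A} (ha : a ∈ S.sqrt) (hb : b ∈ S.sqrt)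
    (h : S.mul a b = some c) : BijMul (a01 a ha : Atom S) (a12 b hb) (a02 c) :=
  ⟨trivial, trivial, Or.inr (Or.inr ⟨a, b, c, ha, hb, h, rfl, rfl, rfl⟩)⟩

theorem SquarePartialGroup.mul_e_eq {a : A} (ha : a ∈ S.sqrt) : S.mul a S.e = some a := by
  obtain ⟨c, hc⟩ := (S.mul_defined_iff a S.e).2 ⟨ha, S.e_mem_sqrt⟩
  rw [hc, S.mul_e hc]

theorem SquarePartialGroup.e_mul_eq {a : A} (ha : a ∈ S.sqrt) : S.mul S.e a = some a := by
  obtain ⟨c, hc⟩ := (S.mul_defined_iff S.e a).2 ⟨S.e_mem_sqrt, ha⟩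
  rw [hc, S.e_mul hc]

/-- If the bijection atoms act as bijections between three sets, respecting their products, then
the partial group embeds into the permutations of the first of these sets. -/
theorem exists_embedsInto_perm {X : Type u} (r : Atom S → SetRel X X)
    (isInj : ∀ p : Atom S, p.IsBij → (r p).IsInj)
    (map_mul : ∀ p q s : Atom S, BijMul p q s → r p ○ r q = r s)
    (dom_eq : ∀ p q : Atom S, p.IsBij → q.IsBij → p.src = q.src → (r p).dom = (r q).dom)
    (cod_eq : ∀ p q : Atom S, p.IsBij → q.IsBij → p.tgt = q.tgt → (r p).cod = (r q).cod)
    (injective : ∀ a b : A, r (a02 a) = r (a02 b) → a = b) :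
    ∃ Y : Set X, S.EmbedsInto (Equiv.Perm Y)ᵐᵒᵖ := by
  let Y (i : Fin 3) : Set X := (r (id i)).dom
  -- The hypotheses match domains with domains and ranges with ranges only. The identity atom, a
  -- partial identity, links the two, so one set serves each sort.
  have cod_id (i : Fin 3) : (r (id i)).cod = Y i := by
    have key {x y : X} (h : (x, y) ∈ r (id i)) : x = y :=
      (isInj (id i) trivial).eq_of_idempotent (map_mul _ _ _ (bijMul_id_id i)) h
    ext x
    constructor
    · rintro ⟨y, h⟩
      obtain rfl := key h
      exact ⟨y, h⟩
    · rintro ⟨y, h⟩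
      obtain rfl := key h
      exact ⟨x, h⟩
  have hex (p : Atom S) (hp : p.IsBij) : ∃ f : Y p.src ≃ Y p.tgt,
      ∀ y z, (y, z) ∈ r p ↔ ∃ hy : y ∈ Y p.src, (f ⟨y, hy⟩ : X) = z :=
    (isInj p hp).exists_equiv (dom_eq p (id p.src) hp trivial rfl)
      ((cod_eq p (id p.tgt) hp trivial rfl).trans (cod_id _))
  have h01 (a : S.sqrt) : ∃ f : Y 0 ≃ Y 1,
      ∀ y z, (y, z) ∈ r (a01 a.1 a.2) ↔ ∃ hy : y ∈ Y 0, (f ⟨y, hy⟩ : X) = z :=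
    hex (a01 a.1 a.2) trivial
  have h12 (a : S.sqrt) : ∃ f : Y 1 ≃ Y 2,
      ∀ y z, (y, z) ∈ r (a12 a.1 a.2) ↔ ∃ hy : y ∈ Y 1, (f ⟨y, hy⟩ : X) = z :=
    hex (a12 a.1 a.2) trivial
  have h02 (a : A) : ∃ f : Y 0 ≃ Y 2,
      ∀ y z, (y, z) ∈ r (a02 a) ↔ ∃ hy : y ∈ Y 0, (f ⟨y, hy⟩ : X) = z :=
    hex (a02 a) trivial
  choose α hα using h01
  choose β hβ using h12
  choose γ hγ using h02
  have comp (a b : S.sqrt) (c : A) (h : S.mul a b = some c) (x : Y 0) :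
      γ c x = β b (α a x) := by
    have h1 : ((x : X), ((β b (α a x) : Y 2) : X)) ∈ r (a02 c) := by
      rw [← map_mul _ _ _ (bijMul_of_mul a.2 b.2 h)]
      exact ⟨_, (hα a _ _).2 ⟨x.2, rfl⟩, (hβ b _ _).2 ⟨(α a x).2, rfl⟩⟩
    obtain ⟨_, h2⟩ := (hγ c _ _).1 h1
    exact Subtype.ext h2
  let e : S.sqrt := ⟨S.e, S.e_mem_sqrt⟩
  -- The opposite group appears because relations compose from left to right and permutations from
  -- right to left.
  refine ⟨Y 0, fun a => MulOpposite.op ((γ a).trans (γ S.e).symm), fun a b hab => ?_,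
    fun a b c h => ?_⟩
  · have hab : γ a = γ b := by
      have := MulOpposite.op_injective hab
      refine Equiv.ext fun x => ?_
      simpa using congrArg (γ S.e) (Equiv.congr_fun this x)
    apply injective
    ext ⟨x, y⟩
    rw [hγ, hγ, hab]
  · obtain ⟨ha, hb⟩ := (S.mul_defined_iff a b).1 ⟨c, h⟩
    rw [← MulOpposite.op_mul]
    congr 1
    ext x
    have ee (x) := comp e e S.e (SquarePartialGroup.mul_e_eq e.2) x
    have ae (x) := comp ⟨a, ha⟩ e a (SquarePartialGroup.mul_e_eq ha) x
    have eb (x) := comp e ⟨b, hb⟩ b (SquarePartialGroup.e_mul_eq hb) x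
    have ab (x) := comp ⟨a, ha⟩ ⟨b, hb⟩ c h x
    -- Both `γ e` and `γ a` end with `β e`, which cancels. Since `γ b` starts with `α e`, the
    -- composite of the two permutations then collapses to `β b ∘ α a = γ c` followed by `γ e`
    -- inverse.
    have key : (γ S.e).symm (γ a x) = (α e).symm (α ⟨a, ha⟩ x) := by
      rw [Equiv.symm_apply_eq, ee, ae, Equiv.apply_symm_apply]
    simp [Equiv.Perm.mul_apply, key, eb, ab]

/-! ### Single atoms as elements of the Boolean monoid -/

variable {hS : S.IsCancellative}

/-- The element of `M(A)` that consists of one atom. -/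
def BM.single (hS : S.IsCancellative) (z : Atom S) : BM S hS := ({z} : Set (Atom S))

theorem BM.single_mul_single {p q s : Atom S} (h : BijMul p q s) :
    BM.single hS p * BM.single hS q = BM.single hS s := by
  change compSet {p} {q} = {s}
  ext z
  simp only [compSet, Set.mem_singleton_iff, exists_eq_left, Set.mem_ofPred_eq,
    comp_bb h.data.1 h.data.2.1]
  exact ⟨fun h' => h'.unique h, fun h' => h' ▸ h⟩

theorem Atom.bijMul_id_right {p : Atom S} (hp : p.IsBij) : BijMul p (id p.tgt) p :=
  ⟨hp, trivial, Or.inr (Or.inl ⟨rfl, rfl⟩)⟩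

theorem Atom.bijMul_id_left {p : Atom S} (hp : p.IsBij) : BijMul (id p.src) p p :=
  ⟨trivial, hp, Or.inl ⟨rfl, rfl⟩⟩

/-- Since `p` is its own product with an identity atom, cancellation excludes `p` from its products
with other bijection atoms. The composition rule excludes it from its products with the `w` atoms.
-/
theorem BM.isInj_single {p : Atom S} (hp : p.IsBij) :
    BooleanMonoid.IsInj (BM.single hS p) := by
  constructor
  · change compSet {p} (idSet S)ᶜ ∩ {p} = ∅
    ext z
    simp only [compSet, Set.mem_singleton_iff, exists_eq_left, Set.mem_inter_iff,
      Set.mem_ofPred_eq, Set.mem_empty_iff_false, iff_false, not_and, forall_exists_index, and_imp]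
    rintro y hy h rfl
    by_cases hyb : y.IsBij
    · exact hy ⟨_, (((comp_bb hp hyb).1 h).cancel_left hS (bijMul_id_right hp)).symm⟩
    · exact ((comp_bw hp hyb).1 h).2.2.2 _ (bijMul_id_right hp)
  · change compSet (idSet S)ᶜ {p} ∩ {p} = ∅
    ext z
    simp only [compSet, Set.mem_singleton_iff, exists_eq_left, Set.mem_inter_iff,
      Set.mem_ofPred_eq, Set.mem_empty_iff_false, iff_false, not_and, forall_exists_index, and_imp]
    rintro y hy h rfl
    by_cases hyb : y.IsBij
    · exact hy ⟨_, (((comp_bb hyb hp).1 h).cancel_right hS (bijMul_id_left hp)).symm⟩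
    · exact ((comp_wb hyb hp).1 h).2.2.2 _ (bijMul_id_left hp)

/-- The atoms omitted from `x · w` are exactly those reached from `x` by a bijection atom. Hence `x
⊤` depends only on the sort at which `x` starts. -/
theorem Atom.exists_comp_right {x t : Atom S} (h : t.src = x.src) : ∃ y, Comp x y t := by
  by_cases hx : x.IsBij
  · by_cases hq : ∃ q, BijMul x q t
    · obtain ⟨q, hq⟩ := hq
      exact ⟨q, (comp_bb hx hq.data.2.1).2 hq⟩
    · exact ⟨w x.tgt t.tgt, (comp_bw hx (not_isBij_w _ _)).2
        ⟨rfl, h, rfl, fun q hq' => hq ⟨q, hq'⟩⟩⟩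
  · exact ⟨w x.tgt t.tgt, (comp_ww hx (not_isBij_w _ _)).2 ⟨rfl, h, rfl⟩⟩

theorem Atom.exists_comp_left {y t : Atom S} (h : t.tgt = y.tgt) : ∃ x, Comp x y t := by
  by_cases hy : y.IsBij
  · by_cases hq : ∃ p, BijMul p y t
    · obtain ⟨p, hp⟩ := hq
      exact ⟨p, (comp_bb hp.data.1 hy).2 hp⟩
    · exact ⟨w t.src y.src, (comp_wb (not_isBij_w _ _) hy).2
        ⟨rfl, rfl, h, fun q hq' => hq ⟨q, hq'⟩⟩⟩
  · exact ⟨w t.src y.src, (comp_ww (not_isBij_w _ _) hy).2 ⟨rfl, rfl, h⟩⟩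

theorem BM.single_mul_top (z : Atom S) :
    BM.single hS z * ⊤ = ({t | t.src = z.src} : Set (Atom S)) := by
  change compSet {z} Set.univ = _
  ext t
  simp only [compSet, Set.mem_singleton_iff, exists_eq_left, Set.mem_univ, true_and,
    Set.mem_ofPred_eq]
  exact ⟨fun ⟨y, hy⟩ => hy.2.1, exists_comp_right⟩

theorem BM.top_mul_single (z : Atom S) :
    ⊤ * BM.single hS z = ({t | t.tgt = z.tgt} : Set (Atom S)) := by
  change compSet Set.univ {z} = _
  ext t
  simp only [compSet, Set.mem_singleton_iff, exists_eq_left, Set.mem_univ, true_and,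
    Set.mem_ofPred_eq]
  exact ⟨fun ⟨y, hy⟩ => hy.2.2.1, exists_comp_left⟩

/-- This simplicity property ensures that no atom is represented by the empty relation once `h ⊤` is
nonempty. -/
theorem BM.top_mul_single_mul_top (z : Atom S) : ⊤ * BM.single hS z * ⊤ = ⊤ := by
  rw [BM.top_mul_single]
  change compSet {t | t.tgt = z.tgt} Set.univ = Set.univ
  ext t
  simp only [Set.mem_univ, iff_true]
  obtain ⟨y, hy⟩ := exists_comp_right (x := w t.src z.tgt) (t := t) rfl
  exact ⟨w t.src z.tgt, rfl, y, trivial, hy⟩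

theorem BM.single_le_compl_single {p q : Atom S} (h : p ≠ q) :
    BM.single hS p ≤ (BM.single hS q)ᶜ := by
  change ({p} : Set (Atom S)) ⊆ {q}ᶜ
  simpa using h.symm

theorem exists_embedsInto_perm_of_isInjDomRanEmbedding {X : Type u}
    {h : BM S hS → SetRel X X} (H : IsInjDomRanEmbedding h) :
    ∃ Y : Set X, S.EmbedsInto (Equiv.Perm Y)ᵐᵒᵖ := by
  refine exists_embedsInto_perm (fun p => h (BM.single hS p))
    (fun p hp => (H.isInj_iff _).1 (BM.isInj_single hp))
    (fun p q s hs => ?_) (fun p q _ _ hpq => ?_) (fun p q _ _ hpq => ?_) (fun a b hab => ?_)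
  · rw [← H.map_mul, BM.single_mul_single hs]
  · apply (H.dom_iff _ _).1
    rw [BooleanMonoid.dom, BooleanMonoid.dom, BM.single_mul_top, BM.single_mul_top, hpq]
  · apply (H.ran_iff _ _).1
    rw [BooleanMonoid.ran, BooleanMonoid.ran, BM.top_mul_single, BM.top_mul_single, hpq]
  · simpa using Set.singleton_injective (H.injective hab)

/-! ### Partial representations and their quotient by `h 1` -/

/-- A map into binary relations that respects composition, order and relative complements, and
for which `h ⊤` is a nonempty partial equivalence relation. -/
structure IsPartialRep {X : Type u} (h : BM S hS → SetRel X X) : Prop where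
  map_mul : ∀ a b, h (a * b) = h a ○ h b
  mono : ∀ a b, a ≤ b → h a ⊆ h b
  map_compl : ∀ a, h aᶜ = h ⊤ \ h a
  symm : ∀ x y, (x, y) ∈ h ⊤ → (y, x) ∈ h ⊤
  trans : ∀ x y z, (x, y) ∈ h ⊤ → (y, z) ∈ h ⊤ → (x, z) ∈ h ⊤
  nonempty : (h ⊤).Nonempty

namespace IsPartialRep

variable {X : Type u} {h : BM S hS → SetRel X X} (H : IsPartialRep h)
include H

theorem mem_top {a : BM S hS} {p : X × X} (hp : p ∈ h a) : p ∈ h ⊤ := H.mono _ _ le_top hp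

theorem not_mem_of_le_compl {a b : BM S hS} (hab : a ≤ bᶜ) {p : X × X} (hp : p ∈ h a) :
    p ∉ h b := by
  have := H.mono _ _ hab hp
  rw [H.map_compl] at this
  exact this.2

theorem mem_one_or {p : X × X} (hp : p ∈ h ⊤) : p ∈ h 1 ∨ p ∈ h 1ᶜ := by
  rw [H.map_compl]
  exact (Classical.em (p ∈ h 1)).imp_right fun hn => ⟨hp, hn⟩

/-- As `h ⊤` is symmetric and transitive, `(y, y')` lies in it, hence in `h 1` or in `h 1ᶜ`. The
second would put `(x, y')` into `h (a * 1ᶜ)`, which is disjoint from `h a`. -/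
theorem right_mem_one {a : BM S hS} (ha : BooleanMonoid.IsInj a) {x y y' : X}
    (h1 : (x, y) ∈ h a) (h2 : (x, y') ∈ h a) : (y, y') ∈ h 1 := by
  refine (H.mem_one_or (H.trans _ _ _ (H.symm _ _ (H.mem_top h1)) (H.mem_top h2))).resolve_right
    fun h3 => ?_
  have h4 : (x, y') ∈ h (a * 1ᶜ) := by
    rw [H.map_mul]
    exact ⟨y, h1, h3⟩
  exact H.not_mem_of_le_compl (disjoint_iff.2 ha.1).le_compl_right h4 h2

theorem left_mem_one {a : BM S hS} (ha : BooleanMonoid.IsInj a) {x x' y : X}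
    (h1 : (x, y) ∈ h a) (h2 : (x', y) ∈ h a) : (x, x') ∈ h 1 := by
  refine (H.mem_one_or (H.trans _ _ _ (H.mem_top h1) (H.symm _ _ (H.mem_top h2)))).resolve_right
    fun h3 => ?_
  have h4 : (x, y) ∈ h (1ᶜ * a) := by
    rw [H.map_mul]
    exact ⟨x', h3, h2⟩
  exact H.not_mem_of_le_compl (disjoint_iff.2 ha.2).le_compl_right h4 h1

omit H in
theorem isInj_one : BooleanMonoid.IsInj (1 : BM S hS) := by
  simp [BooleanMonoid.IsInj]

/-- The factorization `a = a * 1` gives some `z` with `(z, y)` in `h 1`. As `1` is itself in `i`,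
using this pair twice yields `(y, y)`. -/
theorem refl_right {a : BM S hS} {x y : X} (hxy : (x, y) ∈ h a) : (y, y) ∈ h 1 := by
  rw [← mul_one a, H.map_mul] at hxy
  obtain ⟨z, -, hz⟩ := hxy
  exact H.right_mem_one isInj_one hz hz

theorem refl_left {a : BM S hS} {x y : X} (hxy : (x, y) ∈ h a) : (x, x) ∈ h 1 := by
  rw [← one_mul a, H.map_mul] at hxy
  obtain ⟨z, hz, -⟩ := hxy
  exact H.left_mem_one isInj_one hz hz

theorem one_symm {x y : X} (hxy : (x, y) ∈ h 1) : (y, x) ∈ h 1 :=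
  H.right_mem_one isInj_one hxy (H.refl_left hxy)

theorem one_trans {x y z : X} (hxy : (x, y) ∈ h 1) (hyz : (y, z) ∈ h 1) : (x, z) ∈ h 1 := by
  rw [← one_mul 1, H.map_mul]
  exact ⟨y, hxy, hyz⟩

omit H in
/-- The class of `x` with respect to the relation that represents the identity. -/
def cls (h : BM S hS → SetRel X X) (x : X) : Set X := {y | (x, y) ∈ h 1}

theorem cls_eq {x y : X} (hxy : (x, y) ∈ h 1) : cls h x = cls h y :=
  Set.ext fun _ => ⟨fun hz => H.one_trans (H.one_symm hxy) hz, fun hz => H.one_trans hxy hz⟩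

omit H in
theorem one_mem_of_cls_eq {x y : X} (hy : (y, y) ∈ h 1) (hxy : cls h x = cls h y) :
    (x, y) ∈ h 1 :=
  show y ∈ cls h x from hxy ▸ hy

theorem congr {a : BM S hS} {x x' y y' : X} (hxy : (x, y) ∈ h a) (hx : (x', x) ∈ h 1)
    (hy : (y, y') ∈ h 1) : (x', y') ∈ h a := by
  rw [← mul_one a, ← one_mul a, H.map_mul, H.map_mul]
  exact ⟨y, ⟨x, hx, hxy⟩, hy⟩

omit H in
/-- The relation induced by `h a` on the classes. -/
def quot (h : BM S hS → SetRel X X) (a : BM S hS) : SetRel (Set X) (Set X) :=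
  (fun p : X × X => (cls h p.1, cls h p.2)) '' h a

omit H in
theorem mem_quot {a : BM S hS} {x y : X} (hxy : (x, y) ∈ h a) : (cls h x, cls h y) ∈ quot h a :=
  ⟨(x, y), hxy, rfl⟩

/-- Each `h a` is saturated under `h 1`, so passing to classes loses nothing. The pair in `h b` only
serves to make `y` reflexive for `h 1`. -/
theorem of_mem_quot {a b : BM S hS} {x y : X} (hxy : (x, y) ∈ h b)
    (hq : (cls h x, cls h y) ∈ quot h a) : (x, y) ∈ h a := by
  obtain ⟨⟨x', y'⟩, h1, h2⟩ := hq
  simp only [Prod.mk.injEq] at h2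
  exact H.congr h1 (one_mem_of_cls_eq (H.refl_left h1) h2.1.symm)
    (one_mem_of_cls_eq (H.refl_right hxy) h2.2)

theorem quot_mul (a b : BM S hS) : quot h (a * b) = quot h a ○ quot h b := by
  ext ⟨P, Q⟩
  constructor
  · rintro ⟨⟨x, z⟩, h1, h2⟩
    simp only [Prod.mk.injEq] at h2
    obtain ⟨rfl, rfl⟩ := h2
    rw [H.map_mul] at h1
    obtain ⟨y, h1, h2⟩ := h1
    exact ⟨cls h y, mem_quot h1, mem_quot h2⟩
  · rintro ⟨R, ⟨⟨x, y⟩, h1, h2⟩, ⟨⟨y', z⟩, h3, h4⟩⟩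
    simp only [Prod.mk.injEq] at h2 h4
    obtain ⟨rfl, rfl⟩ := h2
    obtain ⟨h5, rfl⟩ := h4
    refine mem_quot (h := h) (a := a * b) ?_
    rw [H.map_mul]
    exact ⟨y, h1, H.congr h3 (one_mem_of_cls_eq (H.refl_left h3) h5.symm) (H.refl_right h3)⟩

theorem quot_isInj {a : BM S hS} (ha : BooleanMonoid.IsInj a) : (quot h a).IsInj := by
  rw [SetRel.isInj_iff]
  constructor
  · rintro _ _ _ ⟨⟨x, y⟩, h1, h2⟩ ⟨⟨x', y'⟩, h3, h4⟩
    simp only [Prod.mk.injEq] at h2 h4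
    obtain ⟨rfl, rfl⟩ := h2
    obtain ⟨rfl, h5⟩ := h4
    exact H.cls_eq (H.left_mem_one ha h1
      (H.congr h3 (H.refl_left h3) (one_mem_of_cls_eq (H.refl_right h1) h5)))
  · rintro _ _ _ ⟨⟨x, y⟩, h1, h2⟩ ⟨⟨x', y'⟩, h3, h4⟩
    simp only [Prod.mk.injEq] at h2 h4
    obtain ⟨rfl, rfl⟩ := h2
    obtain ⟨h5, rfl⟩ := h4
    exact H.cls_eq (H.right_mem_one ha h1
      (H.congr h3 (one_mem_of_cls_eq (H.refl_left h3) h5.symm) (H.refl_right h3)))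

theorem dom_mul_top (a : BM S hS) : (h (a * ⊤)).dom = (h a).dom := by
  ext x
  constructor
  · rintro ⟨z, hz⟩
    rw [H.map_mul] at hz
    exact ⟨_, hz.choose_spec.1⟩
  · rintro ⟨y, hy⟩
    refine ⟨y, ?_⟩
    rw [H.map_mul]
    exact ⟨y, hy, H.mem_top (H.refl_right hy)⟩

theorem cod_top_mul (a : BM S hS) : (h (⊤ * a)).cod = (h a).cod := by
  ext x
  constructor
  · rintro ⟨z, hz⟩
    rw [H.map_mul] at hz
    exact ⟨_, hz.choose_spec.2⟩
  · rintro ⟨y, hy⟩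
    refine ⟨y, ?_⟩
    rw [H.map_mul]
    exact ⟨y, H.mem_top (H.refl_left hy), hy⟩

omit H in
theorem quot_dom (a : BM S hS) : (quot h a).dom = cls h '' (h a).dom := by
  ext P
  constructor
  · rintro ⟨Q, ⟨x, y⟩, h1, h2⟩
    exact ⟨x, ⟨y, h1⟩, congrArg Prod.fst h2⟩
  · rintro ⟨x, ⟨y, h1⟩, rfl⟩
    exact ⟨_, mem_quot h1⟩

omit H in
theorem quot_cod (a : BM S hS) : (quot h a).cod = cls h '' (h a).cod := by
  ext P
  constructor
  · rintro ⟨Q, ⟨x, y⟩, h1, h2⟩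
    exact ⟨y, ⟨x, h1⟩, congrArg Prod.snd h2⟩
  · rintro ⟨x, ⟨y, h1⟩, rfl⟩
    exact ⟨_, mem_quot h1⟩

theorem single_nonempty (z : Atom S) : (h (BM.single hS z)).Nonempty := by
  obtain ⟨⟨x, y⟩, hxy⟩ := H.nonempty
  rw [← BM.top_mul_single_mul_top z, H.map_mul, H.map_mul] at hxy
  obtain ⟨_, ⟨_, -, h1⟩, -⟩ := hxy
  exact ⟨_, h1⟩

theorem exists_embedsInto_perm : ∃ Y : Set (Set X), S.EmbedsInto (Equiv.Perm Y)ᵐᵒᵖ := by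
  refine HirschJackson.exists_embedsInto_perm (fun p => quot h (BM.single hS p))
    (fun p hp => H.quot_isInj (BM.isInj_single hp))
    (fun p q s hs => ?_) (fun p q _ _ hpq => ?_) (fun p q _ _ hpq => ?_) (fun a b hab => ?_)
  · rw [← H.quot_mul, BM.single_mul_single hs]
  · rw [quot_dom, quot_dom, ← H.dom_mul_top, ← H.dom_mul_top (BM.single hS q),
      BM.single_mul_top, BM.single_mul_top, hpq]
  · rw [quot_cod, quot_cod, ← H.cod_top_mul, ← H.cod_top_mul (BM.single hS q),
      BM.top_mul_single, BM.top_mul_single, hpq]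
  -- Injectivity of `h` is not available here. Instead, a pair in the nonempty relation of `a02 a`
  -- would also lie in that of the disjoint atom `a02 b`.
  · by_contra hne
    obtain ⟨⟨x, y⟩, hxy⟩ := H.single_nonempty (a02 a)
    refine H.not_mem_of_le_compl (BM.single_le_compl_single (fun h => hne ?_)) hxy
      (H.of_mem_quot hxy (hab ▸ mem_quot hxy))
    simpa using h

end IsPartialRep

/-! ### Reduction of the three kinds of representation to partial ones -/

theorem BM.top_ne_bot : (⊤ : BM S hS) ≠ ⊥ := by
  intro h
  have h : (Set.univ : Set (Atom S)) = ∅ := h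
  exact Set.notMem_empty (id 0 : Atom S) (h ▸ Set.mem_univ _)

theorem isPartialRep_of_isOrderedComplementedSemigroupRep {X : Type u}
    {h : BM S hS → SetRel X X} (H : IsOrderedComplementedSemigroupRep h)
    (ht : (h ⊤).IsEquivalence) : IsPartialRep h where
  map_mul := H.map_mul
  mono a b hab := (H.map_le_iff a b).1 hab
  map_compl := H.map_compl
  symm _ _ := ht.symm
  trans _ _ _ := ht.trans
  nonempty := by
    rw [Set.nonempty_iff_ne_empty]
    intro h0
    refine BM.top_ne_bot (hS := hS) (H.injective ?_)
    rw [h0, ← compl_top, H.map_compl, Set.sdiff_self]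

/-- Bottom need not be represented by the empty relation, but `h ⊥` absorbs composition with `h ⊤`
on either side. Removing it therefore respects composition, and it turns lattice complements into
relative complements. -/
theorem isPartialRep_diff_bot {X : Type u}
    {h : BM S hS → SetRel X X} (H : IsLatticeOrderedSemigroupRep h)
    (ht : (h ⊤).IsEquivalence) : IsPartialRep fun a => (h a \ h ⊥ : Set (X × X)) := by
  have mono {a b : BM S hS} (hab : a ≤ b) : h a ⊆ h b := by
    rw [← sup_eq_right.2 hab, H.map_sup]
    exact Set.subset_union_left
  have botl {x y z : X} (h1 : (x, y) ∈ h ⊥) (h2 : (y, z) ∈ h ⊤) : (x, z) ∈ h ⊥ := by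
    rw [← BooleanMonoid.bot_mul ⊤, H.map_mul]
    exact ⟨y, h1, h2⟩
  have botr {x y z : X} (h1 : (x, y) ∈ h ⊤) (h2 : (y, z) ∈ h ⊥) : (x, z) ∈ h ⊥ := by
    rw [← BooleanMonoid.mul_bot ⊤, H.map_mul]
    exact ⟨y, h1, h2⟩
  have bots {x y : X} (h1 : (x, y) ∈ h ⊥) : (y, x) ∈ h ⊥ :=
    have h2 := ht.symm (mono le_top h1)
    botl (botr h2 h1) h2
  refine ⟨fun a b => ?_, fun a b hab => Set.sdiff_subset_sdiff_left (mono hab), fun a => ?_,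
    fun x y h1 => ⟨ht.symm h1.1, fun h2 => h1.2 (bots h2)⟩,
    fun x y z h1 h2 => ⟨ht.trans h1.1 h2.1, fun h3 => h1.2 (botl h3 (ht.symm h2.1))⟩, ?_⟩
  · ext ⟨x, z⟩
    constructor
    · rintro ⟨h1, h2⟩
      rw [H.map_mul] at h1
      obtain ⟨y, h3, h4⟩ := h1
      exact ⟨y, ⟨h3, fun h5 => h2 (botl h5 (mono le_top h4))⟩,
        ⟨h4, fun h5 => h2 (botr (mono le_top h3) h5)⟩⟩
    · rintro ⟨y, h1, h2⟩
      refine ⟨?_, fun h3 => h1.2 (botl h3 (ht.symm (mono le_top h2.1)))⟩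
      rw [H.map_mul]
      exact ⟨y, h1.1, h2.1⟩
  · have h1 := H.map_sup a aᶜ
    have h2 := H.map_inf a aᶜ
    rw [sup_compl_eq_top] at h1
    rw [inf_compl_eq_bot] at h2
    rw [h1, h2]
    ext p
    simp only [Set.mem_sdiff, Set.mem_union, Set.mem_inter_iff]
    tauto
  · by_contra h0
    rw [Set.not_nonempty_iff_eq_empty, Set.sdiff_eq_empty] at h0
    exact BM.top_ne_bot (H.injective (h0.antisymm (mono bot_le)))

/-- Here `h ⊤` is only a preorder. Restricting to its symmetric part respects composition: if `x ≤ y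
≤ z ≤ x` in the preorder, all three points are equivalent. -/
theorem isPartialRep_inter_inv {X : Type u}
    {h : BM S hS → SetRel X X} (H : IsBooleanMonoidRep h) :
    IsPartialRep fun a => (h a ∩ (h ⊤).inv : Set (X × X)) := by
  have mono {a b : BM S hS} (hab : a ≤ b) : h a ⊆ h b := by
    rw [← sup_eq_right.2 hab, H.map_sup]
    exact Set.subset_union_left
  have trans {x y z : X} (h1 : (x, y) ∈ h ⊤) (h2 : (y, z) ∈ h ⊤) : (x, z) ∈ h ⊤ := by
    refine mono (le_top (a := ⊤ * ⊤)) ?_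
    rw [H.map_mul]
    exact ⟨y, h1, h2⟩
  refine ⟨fun a b => ?_, fun a b hab => Set.inter_subset_inter_left _ (mono hab), fun a => ?_,
    fun x y h1 => ⟨h1.2, h1.1⟩,
    fun x y z h1 h2 => ⟨trans h1.1 h2.1, trans h2.2 h1.2⟩, ?_⟩
  · ext ⟨x, z⟩
    constructor
    · rintro ⟨h1, h2⟩
      rw [H.map_mul] at h1
      obtain ⟨y, h3, h4⟩ := h1
      exact ⟨y, ⟨h3, trans (mono le_top h4) h2⟩, ⟨h4, trans h2 (mono le_top h3)⟩⟩
    · rintro ⟨y, h1, h2⟩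
      refine ⟨?_, trans h2.2 h1.2⟩
      rw [H.map_mul]
      exact ⟨y, h1.1, h2.1⟩
  · rw [H.map_compl]
    ext p
    simp only [Set.mem_sdiff, Set.mem_inter_iff]
    tauto
  · by_contra h0
    -- Any point of `X` gives a diagonal pair, which survives the restriction. So `X` is empty, and
    -- then `h` identifies top and bottom.
    have hX (x : X) : False := by
      have hx : (x, x) ∈ h ⊤ := by
        refine mono (le_top (a := 1)) ?_
        rw [H.map_one]
        rfl
      exact h0 ⟨(x, x), hx, hx⟩
    refine BM.top_ne_bot (hS := hS) (H.injective ?_)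
    ext ⟨x, y⟩
    exact (hX x).elim

/-! ### The labelling of pairs of points by atoms -/

/-- The element of the partial group that underlies a bijection atom. -/
def Atom.val : Atom S → A
  | a01 a _ => a
  | a12 a _ => a
  | a02 a => a
  -- For identity atoms this value is meant, as `φ` sends it to `1`. For `w` atoms it is a dummy.
  | _ => S.e

theorem Atom.eq_of_val_eq {p q : Atom S} (hp : p.IsBij) (hq : q.IsBij) (hs : p.src = q.src)
    (ht : p.tgt = q.tgt) (hv : p.val = q.val) : p = q := by
  cases p <;> cases q <;> simp_all [IsBij, src, tgt, val] <;> grind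

section Labelling

variable {G : Type u} [Group G] (φ : A → G)

theorem map_e_eq_one (hφ : ∀ a b c : A, S.mul a b = some c → φ a * φ b = φ c) : φ S.e = 1 := by
  simpa using hφ _ _ _ (SquarePartialGroup.mul_e_eq S.e_mem_sqrt)

theorem map_val_mul (hφ : ∀ a b c : A, S.mul a b = some c → φ a * φ b = φ c)
    {p q r : Atom S} (h : BijMul p q r) : φ p.val * φ q.val = φ r.val := by
  have h1 := map_e_eq_one φ hφ
  obtain ⟨-, -, ⟨hp, rfl⟩ | ⟨hq, rfl⟩ | ⟨a, b, c, ha, hb, hc, rfl, rfl, rfl⟩⟩ := h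
  · rw [hp]
    simp [val, h1]
  · rw [hq]
    simp [val, h1]
  · exact hφ a b c hc

/-- The bijection atom `p` links `P` to `Q`. -/
def Links (p : Atom S) (P Q : Fin 3 × G) : Prop :=
  p.IsBij ∧ p.src = P.1 ∧ p.tgt = Q.1 ∧ P.2 * φ p.val = Q.2

open Classical in
/-- The atom that labels a pair of points: the bijection atom that links them, if there is one,
and otherwise the remaining atom of the block. -/
noncomputable def label (S : SquarePartialGroup A) (P Q : Fin 3 × G) : Atom S :=
  if h : ∃ p : Atom S, Links φ p P Q then h.choose else w P.1 Q.1

variable {φ} {P Q R : Fin 3 × G}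

theorem Links.unique (hinj : Function.Injective φ) {p q : Atom S} (hp : Links φ p P Q)
    (hq : Links φ q P Q) : p = q :=
  eq_of_val_eq hp.1 hq.1 (hp.2.1.trans hq.2.1.symm) (hp.2.2.1.trans hq.2.2.1.symm)
    (hinj (mul_left_cancel (hp.2.2.2.trans hq.2.2.2.symm)))

theorem label_eq_of_links (hinj : Function.Injective φ) {p : Atom S} (hp : Links φ p P Q) :
    label φ S P Q = p := by
  have h : ∃ p : Atom S, Links φ p P Q := ⟨p, hp⟩
  rw [label, dif_pos h]
  exact h.choose_spec.unique hinj hp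

theorem links_label (h : (label φ S P Q).IsBij) : Links φ (label φ S P Q) P Q := by
  by_cases h' : ∃ p : Atom S, Links φ p P Q
  · rw [label, dif_pos h']
    exact h'.choose_spec
  · rw [label, dif_neg h'] at h
    exact h.elim

theorem label_eq_w (h : ∀ p : Atom S, ¬ Links φ p P Q) : label φ S P Q = w P.1 Q.1 := by
  rw [label, dif_neg (not_exists.2 h)]

theorem src_label : (label φ S P Q).src = P.1 := by
  by_cases h : (label φ S P Q).IsBij
  · exact (links_label h).2.1
  · rw [label_eq_w fun p hp => h ?_]
    · rfl
    · rw [label, dif_pos ⟨p, hp⟩]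
      exact (Exists.choose_spec (p := fun p => Links φ p P Q) ⟨p, hp⟩).1

theorem tgt_label : (label φ S P Q).tgt = Q.1 := by
  by_cases h : (label φ S P Q).IsBij
  · exact (links_label h).2.2.1
  · rw [label_eq_w fun p hp => h ?_]
    · rfl
    · rw [label, dif_pos ⟨p, hp⟩]
      exact (Exists.choose_spec (p := fun p => Links φ p P Q) ⟨p, hp⟩).1

theorem eq_w_of_not_isBij {z : Atom S} (hz : ¬ z.IsBij) : z = w z.src z.tgt := by
  cases z <;> simp_all [IsBij, src, tgt]

/-- Together with the next two lemmas, a two-out-of-three principle: in a triangle whose sides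
should carry `p`, `q` and their product, any two links force the third, by cancellation in `G`. -/
theorem Links.trans (hφ : ∀ a b c : A, S.mul a b = some c → φ a * φ b = φ c) {p q r : Atom S}
    (h : BijMul p q r) (hp : Links φ p P R) (hq : Links φ q R Q) : Links φ r P Q := by
  refine ⟨h.data.2.2.1, h.data.2.2.2.2.1.trans hp.2.1, h.data.2.2.2.2.2.trans hq.2.2.1, ?_⟩
  rw [← map_val_mul φ hφ h, ← mul_assoc, hp.2.2.2, hq.2.2.2]

theorem Links.of_left (hφ : ∀ a b c : A, S.mul a b = some c → φ a * φ b = φ c) {p q r : Atom S}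
    (h : BijMul p q r) (hp : Links φ p P R) (hr : Links φ r P Q) : Links φ q R Q := by
  refine ⟨h.data.2.1, h.data.2.2.2.1.symm.trans hp.2.2.1,
    h.data.2.2.2.2.2.symm.trans hr.2.2.1, ?_⟩
  rw [← hp.2.2.2, ← hr.2.2.2, ← map_val_mul φ hφ h, mul_assoc]

theorem Links.of_right (hφ : ∀ a b c : A, S.mul a b = some c → φ a * φ b = φ c) {p q r : Atom S}
    (h : BijMul p q r) (hq : Links φ q R Q) (hr : Links φ r P Q) : Links φ p P R := by
  refine ⟨h.data.1, h.data.2.2.2.2.1.symm.trans hr.2.1, h.data.2.2.2.1.trans hq.2.1, ?_⟩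
  apply mul_right_cancel (b := φ q.val)
  rw [mul_assoc, map_val_mul φ hφ h, hr.2.2.2, hq.2.2.2]

/-- Consistency of triangles. If exactly one of the first two sides is a `w` atom, a forbidden third
side would, by two out of three, link that side by a bijection atom. -/
theorem comp_label (hφ : ∀ a b c : A, S.mul a b = some c → φ a * φ b = φ c)
    (hinj : Function.Injective φ) (P R Q : Fin 3 × G) :
    Comp (label φ S P R) (label φ S R Q) (label φ S P Q) := by
  refine ⟨tgt_label.trans src_label.symm, src_label.trans src_label.symm,
    tgt_label.trans tgt_label.symm, fun hx hy => ?_, fun hx hy q hq => ?_, fun hx hy p hp => ?_⟩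
  · obtain ⟨r, hr⟩ := exists_bijMul hx hy (tgt_label.trans src_label.symm)
    rwa [label_eq_of_links hinj (Links.trans hφ hr (links_label hx) (links_label hy))]
  · have := Links.of_left hφ hq (links_label hx) (links_label hq.data.2.2.1)
    rw [label_eq_of_links hinj this] at hy
    exact hy this.1
  · have := Links.of_right hφ hp (links_label hy) (links_label hp.data.2.2.1)
    rw [label_eq_of_links hinj this] at hx
    exact hx this.1

/-- If `G` is large enough, any two points are joined through a third one at a given sort by two
non-bijection atoms. -/
theorem exists_label_eq_w_w (hbig : ∀ g k : G, ∃ r, (∀ a, g * φ a ≠ r) ∧ ∀ a, r * φ a ≠ k)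
    (P Q : Fin 3 × G) (j : Fin 3) :
    ∃ R, label φ S P R = w P.1 j ∧ label φ S R Q = w j Q.1 := by
  obtain ⟨r, h1, h2⟩ := hbig P.2 Q.2
  exact ⟨(j, r), label_eq_w fun p hp => h1 _ hp.2.2.2, label_eq_w fun p hp => h2 _ hp.2.2.2⟩

/-- Witnesses for composition. A bijection atom on one side determines the intermediate point, and
the composition rule then gives the other side its label. Only two `w` atoms require `G` to be
large. -/
theorem exists_label_of_comp (hφ : ∀ a b c : A, S.mul a b = some c → φ a * φ b = φ c)
    (hinj : Function.Injective φ)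
    (hbig : ∀ g k : G, ∃ r, (∀ a, g * φ a ≠ r) ∧ ∀ a, r * φ a ≠ k)
    {x y : Atom S} (h : Comp x y (label φ S P Q)) :
    ∃ R, label φ S P R = x ∧ label φ S R Q = y := by
  have hs : P.1 = x.src := src_label.symm.trans h.2.1
  have ht : Q.1 = y.tgt := tgt_label.symm.trans h.2.2.1
  by_cases hx : x.IsBij
  · have lx : Links φ x P (x.tgt, P.2 * φ x.val) := ⟨hx, hs.symm, rfl, rfl⟩
    refine ⟨_, label_eq_of_links hinj lx, ?_⟩
    by_cases hy : y.IsBij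
    · have h := (comp_bb hx hy).1 h
      exact label_eq_of_links hinj (Links.of_left hφ h lx (links_label h.data.2.2.1))
    · rw [eq_w_of_not_isBij hy, ← h.1, ← ht]
      refine label_eq_w fun q hq => ?_
      obtain ⟨r, hr⟩ := exists_bijMul hx hq.1 hq.2.1.symm
      refine ((comp_bw hx hy).1 h).2.2.2 q ?_
      rwa [label_eq_of_links hinj (Links.trans hφ hr lx hq)]
  · by_cases hy : y.IsBij
    · have ly : Links φ y (y.src, Q.2 * (φ y.val)⁻¹) Q := ⟨hy, rfl, ht.symm, by simp⟩
      refine ⟨_, ?_, label_eq_of_links hinj ly⟩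
      rw [eq_w_of_not_isBij hx, h.1, ← hs]
      refine label_eq_w fun p hp => ?_
      obtain ⟨r, hr⟩ := exists_bijMul hp.1 hy hp.2.2.1
      refine ((comp_wb hx hy).1 h).2.2.2 p ?_
      rwa [label_eq_of_links hinj (Links.trans hφ hr hp ly)]
    · obtain ⟨R, h1, h2⟩ := exists_label_eq_w_w (S := S) hbig P Q x.tgt
      refine ⟨R, ?_, ?_⟩
      · rw [h1, hs, ← eq_w_of_not_isBij hx]
      · rw [h2, ht, h.1, ← eq_w_of_not_isBij hy]

theorem label_surjective (hinj : Function.Injective φ)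
    (hbig : ∀ g k : G, ∃ r, (∀ a, g * φ a ≠ r) ∧ ∀ a, r * φ a ≠ k) (z : Atom S) :
    ∃ P Q : Fin 3 × G, label φ S P Q = z := by
  by_cases hz : z.IsBij
  · exact ⟨(z.src, 1), (z.tgt, φ z.val), label_eq_of_links hinj ⟨hz, rfl, rfl, one_mul _⟩⟩
  · obtain ⟨R, h, -⟩ := exists_label_eq_w_w (S := S) hbig (z.src, 1) (z.src, 1) z.tgt
    exact ⟨_, R, h.trans (eq_w_of_not_isBij hz).symm⟩

theorem label_mem_idSet_iff (hφ : ∀ a b c : A, S.mul a b = some c → φ a * φ b = φ c)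
    (hinj : Function.Injective φ) : label φ S P Q ∈ idSet S ↔ P = Q := by
  have h1 := map_e_eq_one φ hφ
  constructor
  · rintro ⟨i, hi⟩
    have h : Links φ (label φ S P Q) P Q := links_label (hi ▸ trivial)
    rw [← hi] at h
    obtain ⟨-, h2, h3, h4⟩ := h
    refine Prod.ext (h2.symm.trans h3) ?_
    simpa [val, h1] using h4
  · rintro rfl
    exact ⟨P.1, (label_eq_of_links hinj ⟨show IsBij (id P.1) from trivial, rfl, rfl, by simp [val, h1]⟩).symm⟩

variable (φ) in
/-- The representation of `M(A)` given by the labelling of pairs with atoms. -/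
def rep (a : BM S hS) : SetRel (Fin 3 × G) (Fin 3 × G) :=
  (fun p : (Fin 3 × G) × (Fin 3 × G) => label φ S p.1 p.2) ⁻¹' a

theorem isBooleanMonoidRep_rep (hφ : ∀ a b c : A, S.mul a b = some c → φ a * φ b = φ c)
    (hinj : Function.Injective φ)
    (hbig : ∀ g k : G, ∃ r, (∀ a, g * φ a ≠ r) ∧ ∀ a, r * φ a ≠ k) :
    IsBooleanMonoidRep (rep φ : BM S hS → _) where
  injective := by
    refine Function.Surjective.preimage_injective fun z => ?_
    obtain ⟨P, Q, h⟩ := label_surjective hinj hbig z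
    exact ⟨(P, Q), h⟩
  map_mul a b := by
    ext ⟨P, Q⟩
    constructor
    · rintro ⟨x, hx, y, hy, h⟩
      obtain ⟨R, rfl, rfl⟩ := exists_label_of_comp hφ hinj hbig h
      exact ⟨R, hx, hy⟩
    · rintro ⟨R, hx, hy⟩
      exact ⟨_, hx, _, hy, comp_label hφ hinj P R Q⟩
  map_inf _ _ := rfl
  map_sup _ _ := rfl
  map_compl a := by
    ext p
    exact ⟨fun h => ⟨trivial, h⟩, fun h => h.2⟩
  map_one := by
    ext ⟨P, Q⟩
    exact label_mem_idSet_iff hφ hinj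
  map_bot := rfl

end Labelling

/-! ### Enlarging the group -/

/-- Multiplication by `(φ a, 1)` leaves the `ℤ/3` coordinate alone, so it suffices that the
coordinate of `r` differs from those of `g` and `k`. Three values are needed for this. -/
theorem exists_avoiding {G : Type u} [Group G] (φ : A → G)
    (g k : G × Multiplicative (ZMod 3)) :
    ∃ r : G × Multiplicative (ZMod 3), (∀ a, g * (φ a, 1) ≠ r) ∧ ∀ a, r * (φ a, 1) ≠ k := by
  have key : ∀ b c : ZMod 3, ∃ d, b ≠ d ∧ d ≠ c := by decide
  obtain ⟨d, h1, h2⟩ := key g.2.toAdd k.2.toAdd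
  refine ⟨(1, Multiplicative.ofAdd d), fun a h => h1 ?_, fun a h => h2 ?_⟩
  · simpa using congrArg (fun p => p.2.toAdd) h
  · simpa using congrArg (fun p => p.2.toAdd) h

/-- If the partial group embeds into a group, then its Boolean monoid has a representation on
three copies of a product of this group, in which the top element is the full relation. -/
theorem exists_rep_of_embedsInto (hS : S.IsCancellative) {G : Type u} [Group G]
    (H : S.EmbedsInto G) :
    ∃ h : BM S hS → SetRel (Fin 3 × G × Multiplicative (ZMod 3))
      (Fin 3 × G × Multiplicative (ZMod 3)), IsBooleanMonoidRep h ∧ h ⊤ = Set.univ := by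
  obtain ⟨φ, hinj, hφ⟩ := H
  refine ⟨rep fun a => (φ a, 1), isBooleanMonoidRep_rep (fun a b c h => ?_) (fun a b h => ?_)
    (exists_avoiding φ), rfl⟩
  · simp [hφ a b c h]
  · exact hinj (congrArg Prod.fst h)

end HirschJackson

/-! ### Full representations yield the weaker ones -/

namespace IsBooleanMonoidRep

variable {M : Type u} [BooleanMonoid M] {X : Type u} {h : M → SetRel X X}

theorem isLatticeOrderedSemigroupRep (H : IsBooleanMonoidRep h) :
    IsLatticeOrderedSemigroupRep h :=
  ⟨H.injective, H.map_mul, H.map_inf, H.map_sup⟩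

theorem map_le_iff (H : IsBooleanMonoidRep h) (a b : M) : a ≤ b ↔ h a ⊆ h b := by
  rw [← inf_eq_left, ← Set.inter_eq_left, ← H.map_inf, H.injective.eq_iff]

theorem isOrderedComplementedSemigroupRep (H : IsBooleanMonoidRep h) :
    IsOrderedComplementedSemigroupRep h :=
  ⟨H.injective, H.map_mul, H.map_le_iff, H.map_compl⟩

/-- A full top makes `h 1ᶜ` the inequality relation, so the abstract form of `i` says exactly that
the relation is an injective partial map. Likewise, `dom` and `ran` become the restrictions of the
diagonal to the domain and range. -/
theorem isInjDomRanEmbedding (H : IsBooleanMonoidRep h) (ht : h ⊤ = Set.univ) :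
    IsInjDomRanEmbedding h where
  injective := H.injective
  map_mul := H.map_mul
  isInj_iff a := by
    have h1 (x y : X) : (x, y) ∈ h 1ᶜ ↔ x ≠ y := by
      rw [H.map_compl, ht, H.map_one]
      exact ⟨fun h => h.2, fun h => ⟨trivial, h⟩⟩
    rw [BooleanMonoid.IsInj, ← H.injective.eq_iff, ← H.injective.eq_iff (a := 1ᶜ * a ⊓ a),
      H.map_inf, H.map_inf, H.map_mul, H.map_mul, H.map_bot, Set.eq_empty_iff_forall_notMem,
      Set.eq_empty_iff_forall_notMem, SetRel.isInj_iff, and_comm]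
    refine and_congr ⟨fun hd x x' y h2 h3 => ?_, fun hd => ?_⟩
      ⟨fun hd x y y' h2 h3 => ?_, fun hd => ?_⟩
    · by_contra hne
      exact hd (x, y) ⟨⟨x', (h1 _ _).2 hne, h3⟩, h2⟩
    · rintro ⟨x, y⟩ ⟨⟨x', h2, h3⟩, h4⟩
      exact (h1 _ _).1 h2 (hd _ _ _ h4 h3)
    · by_contra hne
      exact hd (x, y') ⟨⟨y, h2, (h1 _ _).2 hne⟩, h3⟩
    · rintro ⟨x, y⟩ ⟨⟨y', h2, h3⟩, h4⟩
      exact (h1 _ _).1 h3 (hd _ _ _ h2 h4)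
  dom_iff a b := by
    have key (a : M) (x y : X) : (x, y) ∈ h (BooleanMonoid.dom a) ↔ x ∈ (h a).dom ∧ x = y := by
      rw [BooleanMonoid.dom, H.map_inf, H.map_mul, ht, H.map_one]
      exact ⟨fun h => ⟨h.1.imp fun _ h => h.1, h.2⟩,
        fun h => ⟨h.1.imp fun _ h => ⟨h, trivial⟩, h.2⟩⟩
    rw [← H.injective.eq_iff]
    constructor
    · intro he
      ext x
      simpa using (key a x x).symm.trans ((Set.ext_iff.1 he (x, x)).trans (key b x x))
    · intro he
      ext ⟨x, y⟩
      rw [key, key, he]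
  ran_iff a b := by
    have key (a : M) (x y : X) : (x, y) ∈ h (BooleanMonoid.ran a) ↔ y ∈ (h a).cod ∧ x = y := by
      rw [BooleanMonoid.ran, H.map_inf, H.map_mul, ht, H.map_one]
      exact ⟨fun h => ⟨h.1.imp fun _ h => h.2, h.2⟩,
        fun h => ⟨h.1.imp fun _ h => ⟨trivial, h⟩, h.2⟩⟩
    rw [← H.injective.eq_iff]
    constructor
    · intro he
      ext x
      simpa using (key a x x).symm.trans ((Set.ext_iff.1 he (x, x)).trans (key b x x))
    · intro he
      ext ⟨x, y⟩
      rw [key, key, he]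

end IsBooleanMonoidRep

theorem SetRel.isEquivalence_univ {X : Type u} {r : SetRel X X} (hr : r = Set.univ) :
    r.IsEquivalence := by
  subst hr
  exact ⟨fun _ => trivial, fun _ => trivial, fun _ _ => trivial⟩

/-! ### The equivalences, unrestricted and finite -/

theorem mainTheorem1 {A : Type u} [Finite A] (S : SquarePartialGroup A) (hS : S.IsCancellative) :
    -- unrestricted version
    List.TFAE [
      ∃ (X : Type u) (h : HirschJackson.BM S hS → SetRel X X), IsBooleanMonoidRep h,
      ∃ (X : Type u) (h : HirschJackson.BM S hS → SetRel X X),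
        IsLatticeOrderedSemigroupRep h ∧ (h ⊤).IsEquivalence,
      ∃ (X : Type u) (h : HirschJackson.BM S hS → SetRel X X),
        IsOrderedComplementedSemigroupRep h ∧ (h ⊤).IsEquivalence,
      ∃ (X : Type u) (h : HirschJackson.BM S hS → SetRel X X), IsInjDomRanEmbedding h,
      ∃ (G : Type u) (_ : Group G), S.EmbedsInto G] ∧
    -- version over a finite base set
    List.TFAE [
      ∃ (X : Type u) (_ : Finite X) (h : HirschJackson.BM S hS → SetRel X X),
        IsBooleanMonoidRep h,
      ∃ (X : Type u) (_ : Finite X) (h : HirschJackson.BM S hS → SetRel X X),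
        IsLatticeOrderedSemigroupRep h ∧ (h ⊤).IsEquivalence,
      ∃ (X : Type u) (_ : Finite X) (h : HirschJackson.BM S hS → SetRel X X),
        IsOrderedComplementedSemigroupRep h ∧ (h ⊤).IsEquivalence,
      ∃ (X : Type u) (_ : Finite X) (h : HirschJackson.BM S hS → SetRel X X),
        IsInjDomRanEmbedding h,
      ∃ (G : Type u) (_ : Group G) (_ : Finite G), S.EmbedsInto G] := by
  have back (Y : Type u) (h : HirschJackson.BM S hS → SetRel Y Y)
      (H : HirschJackson.IsPartialRep h) := H.exists_embedsInto_perm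
  constructor
  · tfae_have 5 → 1 := by
      rintro ⟨G, _, hG⟩
      obtain ⟨h, H, -⟩ := HirschJackson.exists_rep_of_embedsInto hS hG
      exact ⟨_, h, H⟩
    tfae_have 5 → 2 := by
      rintro ⟨G, _, hG⟩
      obtain ⟨h, H, ht⟩ := HirschJackson.exists_rep_of_embedsInto hS hG
      exact ⟨_, h, H.isLatticeOrderedSemigroupRep, SetRel.isEquivalence_univ ht⟩
    tfae_have 5 → 3 := by
      rintro ⟨G, _, hG⟩
      obtain ⟨h, H, ht⟩ := HirschJackson.exists_rep_of_embedsInto hS hG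
      exact ⟨_, h, H.isOrderedComplementedSemigroupRep, SetRel.isEquivalence_univ ht⟩
    tfae_have 5 → 4 := by
      rintro ⟨G, _, hG⟩
      obtain ⟨h, H, ht⟩ := HirschJackson.exists_rep_of_embedsInto hS hG
      exact ⟨_, h, H.isInjDomRanEmbedding ht⟩
    tfae_have 1 → 5 := by
      rintro ⟨X, h, H⟩
      obtain ⟨Y, hY⟩ := back _ _ (HirschJackson.isPartialRep_inter_inv H)
      exact ⟨_, _, hY⟩
    tfae_have 2 → 5 := by
      rintro ⟨X, h, H, ht⟩
      obtain ⟨Y, hY⟩ := back _ _ (HirschJackson.isPartialRep_diff_bot H ht)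
      exact ⟨_, _, hY⟩
    tfae_have 3 → 5 := by
      rintro ⟨X, h, H, ht⟩
      obtain ⟨Y, hY⟩ := back _ _
        (HirschJackson.isPartialRep_of_isOrderedComplementedSemigroupRep H ht)
      exact ⟨_, _, hY⟩
    tfae_have 4 → 5 := by
      rintro ⟨X, h, H⟩
      obtain ⟨Y, hY⟩ := HirschJackson.exists_embedsInto_perm_of_isInjDomRanEmbedding H
      exact ⟨_, _, hY⟩
    tfae_finish
  · tfae_have 5 → 1 := by
      rintro ⟨G, _, _, hG⟩
      obtain ⟨h, H, -⟩ := HirschJackson.exists_rep_of_embedsInto hS hG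
      exact ⟨_, inferInstance, h, H⟩
    tfae_have 5 → 2 := by
      rintro ⟨G, _, _, hG⟩
      obtain ⟨h, H, ht⟩ := HirschJackson.exists_rep_of_embedsInto hS hG
      exact ⟨_, inferInstance, h, H.isLatticeOrderedSemigroupRep, SetRel.isEquivalence_univ ht⟩
    tfae_have 5 → 3 := by
      rintro ⟨G, _, _, hG⟩
      obtain ⟨h, H, ht⟩ := HirschJackson.exists_rep_of_embedsInto hS hG
      exact ⟨_, inferInstance, h, H.isOrderedComplementedSemigroupRep, SetRel.isEquivalence_univ ht⟩
    tfae_have 5 → 4 := by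
      rintro ⟨G, _, _, hG⟩
      obtain ⟨h, H, ht⟩ := HirschJackson.exists_rep_of_embedsInto hS hG
      exact ⟨_, inferInstance, h, H.isInjDomRanEmbedding ht⟩
    tfae_have 1 → 5 := by
      rintro ⟨X, _, h, H⟩
      obtain ⟨Y, hY⟩ := back _ _ (HirschJackson.isPartialRep_inter_inv H)
      -- The group permutes a set of `h 1`-classes, that is, of subsets of the finite set `X`.
      exact ⟨_, _, Finite.of_equiv _ MulOpposite.opEquiv, hY⟩
    tfae_have 2 → 5 := by
      rintro ⟨X, _, h, H, ht⟩
      obtain ⟨Y, hY⟩ := back _ _ (HirschJackson.isPartialRep_diff_bot H ht)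
      exact ⟨_, _, Finite.of_equiv _ MulOpposite.opEquiv, hY⟩
    tfae_have 3 → 5 := by
      rintro ⟨X, _, h, H, ht⟩
      obtain ⟨Y, hY⟩ := back _ _
        (HirschJackson.isPartialRep_of_isOrderedComplementedSemigroupRep H ht)
      exact ⟨_, _, Finite.of_equiv _ MulOpposite.opEquiv, hY⟩
    tfae_have 4 → 5 := by
      rintro ⟨X, _, h, H⟩
      obtain ⟨Y, hY⟩ := HirschJackson.exists_embedsInto_perm_of_isInjDomRanEmbedding H
      exact ⟨_, _, Finite.of_equiv _ MulOpposite.opEquiv, hY⟩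
    tfae_finish
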